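/- Let $N\ge 1$ and $T\ge 2$ be integers. Let $E_n\in\mathbb R$, $\underline x_{n,t},\overline x_{n,t}\in\mathbb R$ ($1\le n\le N$, $1\le t\le T$) and $p\in\mathbb R^T$. In $\mathbb R^{NT}$, with the Euclidean norm $\|x\|_2^2=\sum_{n,t}x_{n,t}^2$, let $$\mathcal X=\Big\{\ell\ :\ \sum_{t}\ell_{n,t}=E_n\ \text{ and }\ \underline x_{n,t}\le \ell_{n,t}\le\overline x_{n,t}\ \text{ for all } n,t\Big\},\qquad \mathcal Y=\Big\{y\ :\ \sum_{n}y_{n,t}=p_t\ \text{ for all } t\Big\},$$ and assume $\mathcal X\ne\emptyset$ (the intersection $\mathcal X\cap\mathcal Y$ may be empty). Let $P_C$ denote the Euclidean projection on a closed convex set $C$. From an arbitrary $y^{(0)}\in\mathbb R^{NT}$ define the alternating projections $$\ell^{(k+1)}=P_{\mathcal X}(y^{(k)}),\qquad y^{(k+1)}=P_{\mathcal Y}(\ell^{(k+1)})\qquad(k\ge 0).$$ Then there are $\ell^\infty\in\mathcal X$ and $y^\infty\in\mathcal Y$ with $\ell^{(k)}\to\ell^\infty$, $y^{(k)}\to y^\infty$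 and $\|\ell^\infty-y^\infty\|_2=\min_{\ell\in\mathcal X,\,y\in\mathcal Y}\|\ell-y\|_2$, such that, with $$\rho_{NT}:=1-\frac{4}{N(T+1)^2(T-1)}<1,$$ one has, for all $k\ge 0$, $$\|y^{(k)}-y^\infty\|_2\le 2\,\|y^{(0)}-y^\infty\|_2\,\rho_{NT}^{\,k},$$ and, whenever $\ell^{(0)}\in\mathbb R^{NT}$ is a point with $y^{(0)}=P_{\mathcal Y}(\ell^{(0)})$, also, for all $k\ge 0$, $$\|\ell^{(k)}-\ell^\infty\|_2\le 2\,\|\ell^{(0)}-\ell^\infty\|_2\,\rho_{NT}^{\,k}.$$ -/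

import Mathlib

/-- The space `ℝ^{NT}` of profiles `(x_{n,t})` for `N` agents and `T` resources, with the
Euclidean (Frobenius) norm `‖x‖² = ∑_{n,t} x_{n,t}²`. -/
abbrev Profile (N T : ℕ) : Type := EuclideanSpace ℝ (Fin N × Fin T)

/-- Admissible profiles of one agent: total demand `E`, and bounds `lb t ≤ x t ≤ ub t` on each
resource. -/
def agentSet {T : ℕ} (E : ℝ) (lb ub : Fin T → ℝ) : Set (Fin T → ℝ) :=
  {x | ∑ t, x t = E ∧ ∀ t, lb t ≤ x t ∧ x t ≤ ub t}

/-- The product `𝒳 = ∏ₙ 𝒳ₙ` of the agents' admissible sets, as a subset of `ℝ^{NT}`. -/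
def feasibleSet {N T : ℕ} (E : Fin N → ℝ) (lb ub : Fin N → Fin T → ℝ) : Set (Profile N T) :=
  {x | ∀ n, (fun t => x (n, t)) ∈ agentSet (E n) (lb n) (ub n)}

/-- The affine space `𝒴_p` of profiles whose sum over the agents is `p`. -/
def aggregateSet {N T : ℕ} (p : Fin T → ℝ) : Set (Profile N T) :=
  {y | ∀ t, ∑ n, y (n, t) = p t}

/-- `z` is the Euclidean projection `P_C(x)` of `x` on the set `C`: the point of `C` closest to
`x` (it exists and is unique when `C` is nonempty, closed and convex). -/
def IsProj {V : Type*} [NormedAddCommGroup V] (C : Set V) (x z : V) : Prop :=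
  z ∈ C ∧ ∀ w ∈ C, ‖x - z‖ ≤ ‖x - w‖

/-- The two infinite sequences produced by the alternate projections method on `X` and `Y`,
started at `y 0`: `ℓ^{(k+1)} = P_X(y^{(k)})` and `y^{(k+1)} = P_Y(ℓ^{(k+1)})`.
The method itself puts no condition on `ℓ 0` and on `y 0`. -/
structure IsAPM {V : Type*} [NormedAddCommGroup V] (X Y : Set V) (l y : ℕ → V) : Prop where
  proj_left : ∀ k, IsProj X (y k) (l (k + 1))
  proj_right : ∀ k, IsProj Y (l (k + 1)) (y (k + 1))

/-- The rate `ρ_{NT} = 1 - 4 / (N (T+1)² (T-1))`. -/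
noncomputable def apmRate (N T : ℕ) : ℝ :=
  1 - 4 / ((N : ℝ) * ((T : ℝ) + 1) ^ 2 * ((T : ℝ) - 1))

/-! Let `v` be the displacement of a minimal pair and `S` the set of `e ∈ 𝒳` with `e + v ∈ 𝒴`; then
each `(e, e + v)` is again a minimal pair, so an empty intersection costs nothing more than a shift.
Everything rests on a regularity estimate: the squared distance from `x ∈ 𝒳` to `S` is at most `N
T(T-1)/2` times that from `x` to `𝒴 - v`.

To prove it, regard the displacement `d` from `x` to its nearest point in `S` as a transfer between
resources. Minimality rules out cycles (`IsReducedTransfer.acyclic`), a cut argument bounds the flow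
through each resource by half the `ℓ¹` norm of the column sums (`IsReducedTransfer.sum_posPart_le`),
and Cauchy–Schwarz yields `IsReducedTransfer.sum_sq_le`.

Pythagoras turns the estimate into a contraction of the distance to the limit set under projection
on `𝒴` (`norm_sub_le_apmRate_mul`). Projection on `𝒳` does not increase this distance, so Fejér
monotonicity gives the limit, the rate and the factor 2 (`IsAPM.exists_limits`). -/

/-! ### Transfers between resources: acyclicity and flow bounds. -/

section Flow

variable {ι τ : Type*} [Fintype ι] [Fintype τ]

/-- Some agent takes from resource `s` and gives to resource `t` in the transfer `d`. -/
def TransferRel (d : ι → τ → ℝ) (s t : τ) : Prop := ∃ n, d n s < 0 ∧ 0 < d n t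

/-- Along a chain of transfers from `s` to `t` the transfer `d` can be reduced, at the cost of
one unit in the column sums at `s` and `t`. -/
theorem exists_reduction_of_transGen [DecidableEq ι] [DecidableEq τ] {d : ι → τ → ℝ} {s t : τ}
    (h : Relation.TransGen (TransferRel d) s t) :
    ∃ g : ι → τ → ℝ, (∀ n, ∑ u, g n u = 0) ∧
      (∀ u, ∑ n, g n u = (if u = s then 1 else 0) - (if u = t then 1 else 0)) ∧
      (∀ n u, (d n u < 0 → 0 ≤ g n u) ∧ (0 < d n u → g n u ≤ 0) ∧ (d n u = 0 → g n u = 0)) ∧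
      ∑ n, ∑ u, d n u * g n u < 0 := by
  have single : ∀ {s t : τ}, TransferRel d s t →
      ∃ g : ι → τ → ℝ, (∀ n, ∑ u, g n u = 0) ∧
      (∀ u, ∑ n, g n u = (if u = s then 1 else 0) - (if u = t then 1 else 0)) ∧
      (∀ n u, (d n u < 0 → 0 ≤ g n u) ∧ (0 < d n u → g n u ≤ 0) ∧ (d n u = 0 → g n u = 0)) ∧
      ∑ n, ∑ u, d n u * g n u < 0 := by
    rintro s t ⟨m, hs, ht⟩
    -- Agent `m` undoes one unit of its transfer: `+1` at `s`, `-1` at `t`.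
    refine ⟨fun n u => if n = m then (if u = s then 1 else 0) - (if u = t then 1 else 0) else 0,
      fun n => ?_, fun u => by simp, fun n u => ?_, ?_⟩
    · by_cases hn : n = m <;> simp [hn]
    · by_cases hn : n = m
      · subst hn
        by_cases h1 : u = s
        · subst h1
          have : u ≠ t := by rintro rfl; linarith
          simp [this]
          exact ⟨by intro h; linarith, hs.ne⟩
        · by_cases h2 : u = t
          · subst h2
            simp [h1]
            exact ⟨fun h => absurd h ht.not_gt, ht.ne'⟩
          · simp [h1, h2]
      · simp [hn]
    · simp [mul_sub]
      linarith
  induction h with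
  | single h => exact single h
  | tail _ h ih =>
    obtain ⟨g, h1, h2, h3, h4⟩ := ih
    obtain ⟨g', h1', h2', h3', h4'⟩ := single h
    refine ⟨fun n u => g n u + g' n u, fun n => ?_, fun u => ?_, fun n u => ⟨fun h => ?_,
      fun h => ?_, fun h => ?_⟩, ?_⟩
    · rw [Finset.sum_add_distrib, h1, h1', add_zero]
    · rw [Finset.sum_add_distrib, h2, h2']; ring
    · exact add_nonneg ((h3 n u).1 h) ((h3' n u).1 h)
    · exact add_nonpos ((h3 n u).2.1 h) ((h3' n u).2.1 h)
    · simp only [(h3 n u).2.2 h, (h3' n u).2.2 h, add_zero]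
    · simp only [mul_add, Finset.sum_add_distrib]
      exact add_neg h4 h4'

/-- `d` has the least Euclidean norm among its reductions with the same row and column sums. -/
def IsReducedTransfer (d : ι → τ → ℝ) : Prop :=
  ∀ d' : ι → τ → ℝ, (∀ n, ∑ u, d' n u = ∑ u, d n u) → (∀ u, ∑ n, d' n u = ∑ n, d n u) →
    (∀ n u, min 0 (d n u) ≤ d' n u ∧ d' n u ≤ max 0 (d n u)) →
    ∑ n, ∑ u, d n u ^ 2 ≤ ∑ n, ∑ u, d' n u ^ 2

theorem exists_pos_mul_abs_le {κ : Type*} [Finite κ] (d g : κ → ℝ) (h : ∀ i, d i = 0 → g i = 0) :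
    ∃ ε : ℝ, 0 < ε ∧ ∀ i, ε * |g i| ≤ |d i| := by
  cases nonempty_fintype κ
  have hev : ∀ i, ∀ᶠ ε : ℝ in nhdsWithin 0 (Set.Ioi 0), ε * |g i| ≤ |d i| := by
    intro i
    by_cases hd : d i = 0
    · simp [hd, h i hd]
    · have h1 : Filter.Tendsto (fun ε : ℝ => ε * |g i|) (nhdsWithin 0 (Set.Ioi 0)) (nhds 0) := by
        have : Filter.Tendsto (fun ε : ℝ => ε * |g i|) (nhds 0) (nhds (0 * |g i|)) :=
          (continuous_id.mul continuous_const).tendsto 0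
        rw [zero_mul] at this
        exact this.mono_left nhdsWithin_le_nhds
      exact h1.eventually_le_const (abs_pos.2 hd)
  obtain ⟨ε, h1, h2⟩ := ((Filter.eventually_all.2 hev).and self_mem_nhdsWithin).exists
  exact ⟨ε, h2, h1⟩

/-- A closed chain gives a reduction direction `g` whose column sums cancel; a small step along `g`
would strictly decrease the norm. -/
theorem IsReducedTransfer.acyclic {d : ι → τ → ℝ} (hd : IsReducedTransfer d) (t : τ) :
    ¬ Relation.TransGen (TransferRel d) t t := by
  classical
  intro h
  obtain ⟨g, h1, h2, h3, h4⟩ := exists_reduction_of_transGen h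
  obtain ⟨ε, hε, hle⟩ := exists_pos_mul_abs_le (fun i : ι × τ => d i.1 i.2) (fun i => g i.1 i.2)
    (fun i => (h3 i.1 i.2).2.2)
  -- As `ε * g` opposes `d` and is no larger in absolute value, `(ε * g)² ≤ -ε * d * g`.
  have key : ∀ n u, min 0 (d n u) ≤ d n u + ε * g n u ∧ d n u + ε * g n u ≤ max 0 (d n u) ∧
      (d n u + ε * g n u) ^ 2 ≤ d n u ^ 2 + ε * (d n u * g n u) := by
    intro n u
    obtain ⟨ha, hb, hc⟩ := h3 n u
    have hl := hle (n, u)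
    simp only at hl
    rcases lt_trichotomy (d n u) 0 with hlt | heq | hgt
    · have hg := ha hlt
      rw [abs_of_neg hlt, abs_of_nonneg hg] at hl
      have : 0 ≤ ε * g n u := by positivity
      refine ⟨?_, ?_, ?_⟩
      · rw [min_eq_right hlt.le]; linarith
      · rw [max_eq_left hlt.le]; linarith
      · nlinarith
    · simp [heq, hc heq]
    · have hg := hb hgt
      rw [abs_of_pos hgt, abs_of_nonpos hg] at hl
      have : ε * g n u ≤ 0 := mul_nonpos_of_nonneg_of_nonpos hε.le hg
      refine ⟨?_, ?_, ?_⟩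
      · rw [min_eq_left hgt.le]; linarith
      · rw [max_eq_right hgt.le]; linarith
      · nlinarith
  have := hd (fun n u => d n u + ε * g n u)
    (fun n => by rw [Finset.sum_add_distrib, ← Finset.mul_sum, h1]; simp)
    (fun u => by rw [Finset.sum_add_distrib, ← Finset.mul_sum, h2]; simp)
    (fun n u => ⟨(key n u).1, (key n u).2.1⟩)
  have h5 : ∑ n, ∑ u, (d n u + ε * g n u) ^ 2 ≤ ∑ n, ∑ u, (d n u ^ 2 + ε * (d n u * g n u)) :=
    Finset.sum_le_sum fun n _ => Finset.sum_le_sum fun u _ => (key n u).2.2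
  simp only [Finset.sum_add_distrib, ← Finset.mul_sum] at h5
  nlinarith

theorem isReducedTransfer_neg {d : ι → τ → ℝ} (hd : IsReducedTransfer d) : IsReducedTransfer (fun n t => - d n t) := by
  intro d' h1 h2 h3
  have := hd (fun n u => - d' n u) (fun n => by simp [h1]) (fun u => by simp [h2])
    (fun n u => by
      have h := h3 n u
      rcases le_total (d n u) 0 with hle | hle
      · rw [min_eq_left (by linarith), max_eq_right (by linarith)] at h
        rw [min_eq_right hle, max_eq_left hle]
        constructor <;> linarith
      · rw [min_eq_right (by linarith), max_eq_left (by linarith)] at h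
        rw [min_eq_left hle, max_eq_right hle]
        constructor <;> linarith)
  simpa using this

/-- The total amount received by a resource is at most half of the `ℓ¹` norm of the column
sums. -/
theorem IsReducedTransfer.sum_posPart_le {d : ι → τ → ℝ} (hd : IsReducedTransfer d) (hrow : ∀ n, ∑ u, d n u = 0)
    (t : τ) : ∑ n, max (d n t) 0 ≤ (∑ u, |∑ n, d n u|) / 2 := by
  classical
  set S : Finset τ := Finset.univ.filter fun s => Relation.TransGen (TransferRel d) s t with hS
  have htS : t ∈ Sᶜ := by simp [hS, hd.acyclic t]
  have hsplit : ∀ f : τ → ℝ, ∑ u, f u = ∑ u ∈ S, f u + ∑ u ∈ Sᶜ, f u := fun f =>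
    (Finset.sum_add_sum_compl S f).symm
  -- The cut: an agent taking from some `s ∉ S` can give neither to `S` nor to `t`, since otherwise
  -- `s` would reach `t`.
  have hrowle : ∀ n, max (d n t) 0 ≤ ∑ u ∈ Sᶜ, d n u := by
    intro n
    by_cases hneg : ∃ s ∈ Sᶜ, d n s < 0
    · obtain ⟨s, hs, hds⟩ := hneg
      have hnonpos : ∀ u ∈ S, d n u ≤ 0 := by
        intro u hu
        by_contra! hpos
        simp only [hS, Finset.mem_filter, Finset.mem_univ, true_and, Finset.mem_compl] at hu hs
        exact hs (Relation.TransGen.head ⟨n, hds, hpos⟩ hu)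
      have hdt : d n t ≤ 0 := by
        by_contra! hpos
        simp only [hS, Finset.mem_filter, Finset.mem_univ, true_and, Finset.mem_compl] at hs
        exact hs (Relation.TransGen.single ⟨n, hds, hpos⟩)
      rw [max_eq_right hdt]
      have := Finset.sum_nonpos hnonpos
      have h0 := hsplit (d n)
      rw [hrow n] at h0
      linarith
    · push Not at hneg
      exact max_le (Finset.single_le_sum hneg htS) (Finset.sum_nonneg hneg)
  have h1 : ∑ n, max (d n t) 0 ≤ ∑ u ∈ Sᶜ, ∑ n, d n u := by
    rw [Finset.sum_comm]
    exact Finset.sum_le_sum fun n _ => hrowle n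
  have h2 : ∑ u, ∑ n, d n u = 0 := by
    rw [Finset.sum_comm]
    exact Finset.sum_eq_zero fun n _ => hrow n
  rw [hsplit] at h2
  have h3 : ∑ u ∈ Sᶜ, ∑ n, d n u ≤ ∑ u ∈ Sᶜ, |∑ n, d n u| :=
    Finset.sum_le_sum fun u _ => le_abs_self _
  have h4 : -∑ u ∈ S, ∑ n, d n u ≤ ∑ u ∈ S, |∑ n, d n u| := by
    rw [← Finset.sum_neg_distrib]
    exact Finset.sum_le_sum fun u _ => neg_le_abs _
  rw [hsplit (fun u => |∑ n, d n u|)]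
  linarith

/-- If a reduced transfer is nonzero, some resource only gives, and another one only receives. -/
theorem IsReducedTransfer.exists_extremes {d : ι → τ → ℝ} (hd : IsReducedTransfer d) (hrow : ∀ n, ∑ u, d n u = 0)
    (h0 : ∃ n u, d n u ≠ 0) :
    ∃ s t, s ≠ t ∧ (∀ n, d n s ≤ 0) ∧ (∀ n, 0 ≤ d n t) := by
  obtain ⟨n, u, hnu⟩ := h0
  obtain ⟨s, hs⟩ : ∃ s, d n s < 0 := by
    by_contra! h
    exact hnu ((Finset.sum_eq_zero_iff_of_nonneg fun u _ => h u).1 (hrow n) u (Finset.mem_univ _))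
  obtain ⟨t, ht⟩ : ∃ t, 0 < d n t := by
    by_contra! h
    exact hnu ((Finset.sum_eq_zero_iff_of_nonpos fun u _ => h u).1 (hrow n) u (Finset.mem_univ _))
  let r := Relation.TransGen (TransferRel d)
  have : Std.Irrefl r := ⟨hd.acyclic⟩
  have : IsTrans τ r := ⟨fun _ _ _ => Relation.TransGen.trans⟩
  have hwf : WellFounded r := Finite.wellFounded_of_trans_of_irrefl r
  have hwf' : WellFounded (Function.swap r) := Finite.wellFounded_of_trans_of_irrefl _
  -- A minimal ancestor of `s` receives nothing, and a maximal descendant of `t` gives nothing. They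
  -- differ, because the transfer from `s` to `t` would otherwise close a cycle.
  obtain ⟨a, ha, hamin⟩ := hwf.has_min {a | Relation.ReflTransGen (TransferRel d) a s} ⟨s, .refl⟩
  obtain ⟨b, hb, hbmin⟩ := hwf'.has_min {b | Relation.ReflTransGen (TransferRel d) t b} ⟨t, .refl⟩
  refine ⟨a, b, ?_, fun m => ?_, fun m => ?_⟩
  · rintro rfl
    exact hd.acyclic a (Relation.TransGen.trans_right ha
      (Relation.TransGen.head' ⟨n, hs, ht⟩ hb))
  · by_contra! hpos
    obtain ⟨c, hc⟩ : ∃ c, d m c < 0 := by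
      by_contra! h
      exact hpos.ne' ((Finset.sum_eq_zero_iff_of_nonneg fun u _ => h u).1 (hrow m) a
        (Finset.mem_univ _))
    exact hamin c (.head ⟨m, hc, hpos⟩ ha) (.single ⟨m, hc, hpos⟩)
  · by_contra! hneg
    obtain ⟨c, hc⟩ : ∃ c, 0 < d m c := by
      by_contra! h
      exact hneg.ne ((Finset.sum_eq_zero_iff_of_nonpos fun u _ => h u).1 (hrow m) b
        (Finset.mem_univ _))
    exact hbmin c (.tail hb ⟨m, hneg, hc⟩) (.single ⟨m, hneg, hc⟩)

/-- Regularity: the norm of a reduced transfer is controlled by its column sums. -/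
theorem IsReducedTransfer.sum_sq_le {d : ι → τ → ℝ} (hd : IsReducedTransfer d) (hrow : ∀ n, ∑ u, d n u = 0)
    (hτ : 2 ≤ Fintype.card τ) :
    ∑ n, ∑ u, d n u ^ 2 ≤
      (Fintype.card τ : ℝ) * (Fintype.card τ - 1) / 2 * ∑ u, (∑ n, d n u) ^ 2 := by
  classical
  have hτ' : (2 : ℝ) ≤ Fintype.card τ := by exact_mod_cast hτ
  have hΔ : 0 ≤ ∑ u, (∑ n, d n u) ^ 2 := Finset.sum_nonneg fun u _ => sq_nonneg _
  by_cases h0 : ∃ n u, d n u ≠ 0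
  swap
  · push Not at h0
    simp [h0]
  obtain ⟨s, t, hst, hs, ht⟩ := hd.exists_extremes hrow h0
  set F : ℝ := (∑ u, |∑ n, d n u|) / 2 with hF
  have hF0 : 0 ≤ F := div_nonneg (Finset.sum_nonneg fun u _ => abs_nonneg _) (by norm_num)
  have hFsq : F ^ 2 ≤ Fintype.card τ / 4 * ∑ u, (∑ n, d n u) ^ 2 := by
    have := sq_sum_le_card_mul_sum_sq (s := (Finset.univ : Finset τ)) (f := fun u => |∑ n, d n u|)
    simp only [sq_abs, Finset.card_univ] at this
    rw [hF, div_pow]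
    linarith
  let inflow : τ → ℝ := fun u => ∑ n, max (d n u) 0
  let outflow : τ → ℝ := fun u => ∑ n, max (-d n u) 0
  have hin : ∀ u, inflow u ≤ F := hd.sum_posPart_le hrow
  have hout : ∀ u, outflow u ≤ F := fun u => by
    have := (isReducedTransfer_neg hd).sum_posPart_le (fun n => by simp [hrow]) u
    simpa [hF] using this
  have hin0 : ∀ u, 0 ≤ inflow u := fun u => Finset.sum_nonneg fun n _ => le_max_right _ _
  have hout0 : ∀ u, 0 ≤ outflow u := fun u => Finset.sum_nonneg fun n _ => le_max_right _ _
  have hnet : ∀ u, inflow u - outflow u = ∑ n, d n u := fun u => by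
    simp only [inflow, outflow, ← Finset.sum_sub_distrib]
    refine Finset.sum_congr rfl fun n _ => ?_
    rcases le_total (d n u) 0 with h | h
    · rw [max_eq_right h, max_eq_left (by linarith)]; ring
    · rw [max_eq_left h, max_eq_right (by linarith)]; ring
  -- `inflow² + outflow² = (inflow - outflow)² + 2 * inflow * outflow`.
  have hcol : ∀ u, ∑ n, d n u ^ 2 ≤ (∑ n, d n u) ^ 2 + 2 * (inflow u * outflow u) := fun u => by
    have h1 : ∑ n, d n u ^ 2 = ∑ n, max (d n u) 0 ^ 2 + ∑ n, max (-d n u) 0 ^ 2 := by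
      rw [← Finset.sum_add_distrib]
      refine Finset.sum_congr rfl fun n _ => ?_
      rcases le_total (d n u) 0 with h | h
      · rw [max_eq_right h, max_eq_left (by linarith)]; ring
      · rw [max_eq_left h, max_eq_right (by linarith)]; ring
    have h2 : ∑ n, max (d n u) 0 ^ 2 ≤ inflow u ^ 2 :=
      Finset.sum_sq_le_sq_sum_of_nonneg fun n _ => le_max_right _ _
    have h3 : ∑ n, max (-d n u) 0 ^ 2 ≤ outflow u ^ 2 :=
      Finset.sum_sq_le_sq_sum_of_nonneg fun n _ => le_max_right _ _
    rw [h1, ← hnet u]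
    linarith
  -- The product vanishes at the two extreme resources, which leaves `card τ - 2` terms.
  have hprod : ∀ u, inflow u * outflow u ≤
      F ^ 2 * (1 - (if u = s then 1 else 0) - (if u = t then 1 else 0)) := fun u => by
    by_cases h1 : u = s
    · subst h1
      have : inflow u = 0 := Finset.sum_eq_zero fun n _ => max_eq_right (hs n)
      simp [this, hst]
    · by_cases h2 : u = t
      · subst h2
        have : outflow u = 0 := Finset.sum_eq_zero fun n _ => max_eq_right (by linarith [ht n])
        simp [this, h1]
      · simp only [h1, h2, if_false, sub_zero, mul_one]
        rw [sq]
        exact mul_le_mul (hin u) (hout u) (hout0 u) hF0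
  have hsum : ∑ n, ∑ u, d n u ^ 2 ≤
      ∑ u, (∑ n, d n u) ^ 2 + 2 * (F ^ 2 * (Fintype.card τ - 2)) := by
    rw [Finset.sum_comm]
    refine (Finset.sum_le_sum fun u _ => hcol u).trans ?_
    rw [Finset.sum_add_distrib, ← Finset.mul_sum]
    have := Finset.sum_le_sum fun u (_ : u ∈ Finset.univ) => hprod u
    rw [← Finset.mul_sum] at this
    simp only [Finset.sum_sub_distrib, Finset.sum_ite_eq', Finset.mem_univ, if_true,
      Finset.sum_const, Finset.card_univ, nsmul_eq_mul, mul_one] at this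
    have h : (Fintype.card τ : ℝ) - 1 - 1 = Fintype.card τ - 2 := by ring
    rw [h] at this
    linarith
  have h6 : F ^ 2 * (Fintype.card τ - 2) ≤
      Fintype.card τ / 4 * (∑ u, (∑ n, d n u) ^ 2) * (Fintype.card τ - 2) :=
    mul_le_mul_of_nonneg_right hFsq (by linarith)
  -- The slack between the bound obtained, `1 + T(T-2)/2`, and `T(T-1)/2` is `(T-2)/2`.
  have h7 : 0 ≤ ((Fintype.card τ : ℝ) - 2) * ∑ u, (∑ n, d n u) ^ 2 :=
    mul_nonneg (by linarith) hΔ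
  linarith

end Flow

/-! ### Projections, Fejér monotone sequences and alternating projections. -/

section APM

variable {V : Type*} [NormedAddCommGroup V] [InnerProductSpace ℝ V]

theorem IsProj.inner_le_zero {C : Set V} (hC : Convex ℝ C) {x z : V} (h : IsProj C x z) {w : V}
    (hw : w ∈ C) : inner ℝ (x - z) (w - z) ≤ 0 := by
  refine (norm_eq_iInf_iff_real_inner_le_zero hC h.1).1 ?_ w hw
  have : Nonempty C := ⟨⟨z, h.1⟩⟩
  refine le_antisymm (le_ciInf fun w => h.2 w w.2) ?_
  exact ciInf_le ⟨0, by rintro _ ⟨w, rfl⟩; exact norm_nonneg _⟩ (⟨z, h.1⟩ : C)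

theorem IsProj.inner_eq_zero {C : AffineSubspace ℝ V} {x z : V} (h : IsProj (C : Set V) x z)
    {a b : V} (ha : a ∈ C) (hb : b ∈ C) : inner ℝ (x - z) (a - b) = 0 := by
  have hz : z ∈ C := h.1
  have h1 := h.inner_le_zero C.convex (AffineSubspace.vadd_mem_of_mem_direction
    (AffineSubspace.vsub_mem_direction ha hb) hz)
  have h2 := h.inner_le_zero C.convex (AffineSubspace.vadd_mem_of_mem_direction
    (AffineSubspace.vsub_mem_direction hb ha) hz)
  simp only [vsub_eq_sub, vadd_eq_add, add_sub_cancel_right] at h1 h2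
  rw [← neg_sub a b, inner_neg_right] at h2
  linarith

theorem norm_le_of_sq_le_inner {a b : V} (h : ‖a‖ ^ 2 ≤ inner ℝ a b) : ‖a‖ ≤ ‖b‖ := by
  have := real_inner_le_norm a b
  by_contra! hlt
  nlinarith [norm_nonneg a, norm_nonneg b]

/-- Adding the variational inequalities at `z` and `z'` gives `‖z - z'‖² ≤ ⟪z - z', x - x'⟫`. -/
theorem IsProj.norm_sub_le {C : Set V} (hC : Convex ℝ C) {x x' z z' : V} (h : IsProj C x z)
    (h' : IsProj C x' z') : ‖z - z'‖ ≤ ‖x - x'‖ := by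
  apply norm_le_of_sq_le_inner
  have h1 := h.inner_le_zero hC h'.1
  have h2 := h'.inner_le_zero hC h.1
  rw [← real_inner_self_eq_norm_sq]
  simp only [inner_sub_left, inner_sub_right, real_inner_comm] at *
  linarith [real_inner_comm x z, real_inner_comm x z', real_inner_comm x' z,
    real_inner_comm x' z', real_inner_comm z z']

/-- A Fejér monotone sequence whose distance to the target set decays geometrically converges
geometrically. -/
theorem exists_tendsto_of_fejer {V : Type*} [NormedAddCommGroup V] [CompleteSpace V] {S : Set V} (hS : IsClosed S)
    (hne : S.Nonempty) {s : ℕ → V} {ρ : ℝ} (hρ0 : 0 ≤ ρ) (hρ1 : ρ < 1)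
    (hfejer : ∀ e ∈ S, ∀ k, ‖s (k + 1) - e‖ ≤ ‖s k - e‖)
    (hdist : ∀ k, Metric.infDist (s (k + 1)) S ≤ ρ * Metric.infDist (s k) S) :
    ∃ a ∈ S, Filter.Tendsto s Filter.atTop (nhds a) ∧
      ∀ k, ‖s k - a‖ ≤ 2 * ‖s 0 - a‖ * ρ ^ k := by
  have hanti : ∀ e ∈ S, Antitone fun k => ‖s k - e‖ := fun e he =>
    antitone_nat_of_succ_le (hfejer e he)
  have hpow : ∀ k, Metric.infDist (s k) S ≤ ρ ^ k * Metric.infDist (s 0) S := by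
    intro k
    induction k with
    | zero => simp
    | succ k ih =>
      refine (hdist k).trans ((mul_le_mul_of_nonneg_left ih hρ0).trans_eq ?_)
      ring
  -- Both iterates are nearly within `infDist (s k) S` of one point of `S`; this is the origin of
  -- the factor 2.
  have hcl : ∀ k j, k ≤ j → dist (s k) (s j) ≤ 2 * Metric.infDist (s k) S := by
    intro k j hkj
    refine le_of_forall_pos_lt_add fun ε hε => ?_
    obtain ⟨e, he, hlt⟩ := (Metric.infDist_lt_iff hne).1
      (lt_add_of_pos_right (Metric.infDist (s k) S) (half_pos hε))
    have h1 := hanti e he hkj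
    simp only [← dist_eq_norm] at h1
    have h2 := dist_triangle_right (s k) (s j) e
    linarith
  have hlim0 : Filter.Tendsto (fun k => ρ ^ k * Metric.infDist (s 0) S) Filter.atTop (nhds 0) := by
    simpa using (tendsto_pow_atTop_nhds_zero_of_lt_one hρ0 hρ1).mul_const (Metric.infDist (s 0) S)
  have hcauchy : CauchySeq s := by
    refine cauchySeq_of_le_tendsto_0' (fun k => 2 * (ρ ^ k * Metric.infDist (s 0) S))
      (fun k j hkj => (hcl k j hkj).trans ?_) ?_
    · have := hpow k
      linarith
    · simpa using hlim0.const_mul 2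
  obtain ⟨a, ha⟩ := cauchySeq_tendsto_of_complete hcauchy
  have hinf : Metric.infDist a S = 0 := by
    have h1 : Filter.Tendsto (fun k => Metric.infDist (s k) S) Filter.atTop
        (nhds (Metric.infDist a S)) := ((Metric.continuous_infDist_pt S).tendsto a).comp ha
    exact tendsto_nhds_unique h1
      (squeeze_zero (fun k => Metric.infDist_nonneg) hpow hlim0)
  have haS : a ∈ S := (hS.mem_iff_infDist_zero hne).2 hinf
  refine ⟨a, haS, ha, fun k => ?_⟩
  have h1 : dist (s k) a ≤ 2 * Metric.infDist (s k) S :=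
    le_of_tendsto (tendsto_const_nhds.dist ha) (Filter.eventually_atTop.2 ⟨k, hcl k⟩)
  have h2 : Metric.infDist (s 0) S ≤ ‖s 0 - a‖ := by
    rw [← dist_eq_norm]; exact Metric.infDist_le_dist_of_mem haS
  rw [← dist_eq_norm]
  have h3 := mul_le_mul_of_nonneg_left h2 (pow_nonneg hρ0 k)
  have h4 := hpow k
  linarith

/-- Linear convergence of the alternate projections between a compact convex set `X` and an
affine space `Y`, from a pair `x₀, y₀` at minimal distance and a contraction estimate for the
projection on `Y` of the points of `X`. -/
theorem IsAPM.exists_limits [CompleteSpace V] {X : Set V} (hXc : IsCompact X)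
    (hXconv : Convex ℝ X) {Y : AffineSubspace ℝ V} (hYc : IsClosed (Y : Set V)) {x₀ y₀ : V}
    (hx₀ : x₀ ∈ X) (hy₀ : y₀ ∈ Y) (hmin : ∀ x ∈ X, ∀ z ∈ Y, ‖x₀ - y₀‖ ≤ ‖x - z‖)
    {ρ : ℝ} (hρ0 : 0 ≤ ρ) (hρ1 : ρ < 1)
    (hreg : ∀ x ∈ X, ∀ e, IsProj {e | e ∈ X ∧ e + (y₀ - x₀) ∈ Y} x e → ∀ z, IsProj (Y : Set V) x z →
      ‖z - (e + (y₀ - x₀))‖ ≤ ρ * ‖x - e‖)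
    {l y : ℕ → V} (h : IsAPM X (Y : Set V) l y) :
    ∃ a ∈ X, ∃ b ∈ Y, Filter.Tendsto l Filter.atTop (nhds a) ∧
      Filter.Tendsto y Filter.atTop (nhds b) ∧ (∀ x ∈ X, ∀ z ∈ Y, ‖a - b‖ ≤ ‖x - z‖) ∧
      (IsProj (Y : Set V) (l 0) (y 0) → ∀ k, ‖l k - a‖ ≤ 2 * ‖l 0 - a‖ * ρ ^ k) ∧
      ∀ k, ‖y k - b‖ ≤ 2 * ‖y 0 - b‖ * ρ ^ k := by
  set v : V := y₀ - x₀ with hv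
  set S : Set V := {e | e ∈ X ∧ e + v ∈ Y} with hS
  set S' : Set V := {b | b - v ∈ S} with hS'
  have hclS : IsClosed S := hXc.isClosed.inter (hYc.preimage (continuous_id.add continuous_const))
  have hcpt : IsCompact S := hXc.of_isClosed_subset hclS fun e he => he.1
  have hclS' : IsClosed S' := hclS.preimage (continuous_id.sub continuous_const)
  have hneS : S.Nonempty := ⟨x₀, hx₀, by simpa [hv] using hy₀⟩
  have hneS' : S'.Nonempty := hneS.imp' (· + v) fun e he => by simpa [hS'] using he
  have hnorm : ∀ e : V, ‖e - (e + v)‖ = ‖x₀ - y₀‖ := fun e => by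
    rw [hv, sub_add_eq_sub_sub, sub_self, zero_sub, neg_sub]
  have hprojX : ∀ e ∈ S, IsProj X (e + v) e := fun e he =>
    ⟨he.1, fun w hw => by rw [norm_sub_rev, hnorm, norm_sub_rev (e + v)]; exact hmin w hw _ he.2⟩
  have hprojY : ∀ e ∈ S, IsProj (Y : Set V) e (e + v) := fun e he =>
    ⟨he.2, fun w hw => by rw [hnorm]; exact hmin e he.1 w hw⟩
  have hnear : ∀ x, ∃ e, IsProj S x e ∧ ‖x - e‖ = Metric.infDist x S := fun x => by
    obtain ⟨e, he, heq⟩ := hcpt.exists_infDist_eq_dist hneS x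
    rw [dist_eq_norm] at heq
    exact ⟨e, ⟨he, fun w hw => by
      rw [← heq, ← dist_eq_norm]; exact Metric.infDist_le_dist_of_mem hw⟩, heq.symm⟩
  have hshift : ∀ x, Metric.infDist x S' = Metric.infDist (x - v) S := fun x => by
    have : S' = (· + v) '' S := by
      ext b
      constructor
      · intro hb; exact ⟨b - v, hb, by simp⟩
      · rintro ⟨e, he, rfl⟩; simpa [hS'] using he
    have h1 := Metric.infDist_image (isometry_add_right v) (x := x - v) (t := S)
    rw [this]
    simpa using h1
  have hYconv : Convex ℝ (Y : Set V) := Y.convex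
  -- one-step estimates
  have hfejX : ∀ {y l}, IsProj X y l → ∀ e ∈ S, ‖l - e‖ ≤ ‖y - (e + v)‖ := fun hp e he =>
    hp.norm_sub_le hXconv (hprojX e he)
  have hfejY : ∀ {l y}, IsProj (Y : Set V) l y → ∀ e ∈ S, ‖y - (e + v)‖ ≤ ‖l - e‖ :=
    fun hp e he => hp.norm_sub_le hYconv (hprojY e he)
  have hdX : ∀ {y l}, IsProj X y l → Metric.infDist l S ≤ Metric.infDist y S' := by
    intro y l hp
    obtain ⟨e, he, heq⟩ := hnear (y - v)
    rw [hshift, ← heq]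
    refine (Metric.infDist_le_dist_of_mem he.1).trans ?_
    rw [dist_eq_norm]
    refine (hfejX hp e he.1).trans_eq ?_
    congr 1; abel
  have hdY : ∀ {l y}, IsProj (Y : Set V) l y → Metric.infDist y S' ≤ Metric.infDist l S := by
    intro l y hp
    obtain ⟨e, he, heq⟩ := hnear l
    rw [hshift, ← heq]
    refine (Metric.infDist_le_dist_of_mem he.1).trans ?_
    rw [dist_eq_norm]
    refine Eq.trans_le ?_ (hfejY hp e he.1)
    congr 1; abel
  have hcY : ∀ {l y}, l ∈ X → IsProj (Y : Set V) l y →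
      Metric.infDist y S' ≤ ρ * Metric.infDist l S := by
    intro l y hl hp
    obtain ⟨e, he, heq⟩ := hnear l
    rw [hshift, ← heq]
    refine (Metric.infDist_le_dist_of_mem he.1).trans ?_
    rw [dist_eq_norm]
    refine Eq.trans_le ?_ (hreg l hl e he y hp)
    congr 1; abel
  have hex : ∀ x, ∃ z, IsProj (Y : Set V) x z := fun x => by
    obtain ⟨z, hz, heq⟩ := exists_norm_eq_iInf_of_complete_convex ⟨y₀, hy₀⟩ hYc.isComplete hYconv x
    refine ⟨z, hz, fun w hw => ?_⟩
    rw [heq]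
    exact ciInf_le ⟨0, by rintro _ ⟨w, rfl⟩; exact norm_nonneg _⟩ (⟨w, hw⟩ : (Y : Set V))
  have hSconv : Convex ℝ S := by
    intro a ha b hb s t hs ht hst
    refine ⟨hXconv ha.1 hb.1 hs ht hst, ?_⟩
    have h1 := hYconv ha.2 hb.2 hs ht hst
    have : s • (a + v) + t • (b + v) = s • a + t • b + v := by
      rw [smul_add, smul_add, add_add_add_comm, ← add_smul, hst, one_smul]
    rwa [this] at h1
  -- The contraction passes to the projection on `X` by duality: `‖l - e‖² ≤ ⟪z - (e + v), y - v -
  -- e'⟫`, where `hreg` bounds the first factor by `ρ * ‖l - e‖`.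
  have hcX : ∀ {y l}, y ∈ Y → IsProj X y l → Metric.infDist l S ≤ ρ * Metric.infDist y S' := by
    intro y l hy hp
    obtain ⟨e', he', heq'⟩ := hnear (y - v)
    obtain ⟨e, he, heq⟩ := hnear l
    obtain ⟨z, hz⟩ := hex l
    rw [hshift, ← heq', ← heq]
    have h1 : inner ℝ (y - l) (e - l) ≤ 0 := hp.inner_le_zero hXconv he.1.1
    have h2 : inner ℝ (e + v - e) (l - e) ≤ 0 := (hprojX e he.1).inner_le_zero hXconv hp.1
    have h3 : inner ℝ (l - e) (e' - e) ≤ 0 := he.inner_le_zero hSconv he'.1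
    have h4 : inner ℝ (l - z) (y - (e' + v)) = 0 := hz.inner_eq_zero hy he'.1.2
    have h5 : inner ℝ (e - (e + v)) (y - (e' + v)) = 0 :=
      (hprojY e he.1).inner_eq_zero hy he'.1.2
    have h6 := hreg l hp.1 e he z hz
    have h7 : inner ℝ (l - e) (l - e) ≤ inner ℝ (z - (e + v)) (y - v - e') := by
      have e1 : inner ℝ (z - (e + v)) (y - v - e') = inner ℝ (l - e) (l - e)
          + inner ℝ (y - l) (l - e) - inner ℝ (e + v - e) (l - e) - inner ℝ (l - e) (e' - e)
          - inner ℝ (l - z) (y - (e' + v)) + inner ℝ (e - (e + v)) (y - (e' + v)) := by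
        rw [real_inner_comm (l - e) (y - l), real_inner_comm (l - e) (e + v - e)]
        rw [← inner_add_right, ← inner_sub_right, ← inner_sub_right, sub_add, ← inner_sub_left]
        have : z - (e + v) = (l - e) - (l - z - (e - (e + v))) := by abel
        rw [this, inner_sub_left]
        congr 1 <;> congr 1 <;> abel
      have e2 : inner ℝ (y - l) (l - e) = - inner ℝ (y - l) (e - l) := by
        rw [← inner_neg_right, neg_sub]
      rw [e1, e2]
      linarith
    rw [real_inner_self_eq_norm_sq] at h7
    have h8 := real_inner_le_norm (z - (e + v)) (y - v - e')
    have h9 := mul_le_mul_of_nonneg_right h6 (norm_nonneg (y - v - e'))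
    by_contra! hlt
    have hpos : 0 < ‖l - e‖ := lt_of_le_of_lt (by positivity) hlt
    nlinarith
  obtain ⟨b, hb, hby, hrate⟩ := exists_tendsto_of_fejer hclS' hneS' hρ0 hρ1 (s := y)
    (fun b hb k => by
      have h1 := hfejX (h.proj_left k) _ hb
      have h2 := hfejY (h.proj_right k) _ hb
      rw [sub_add_cancel] at h1 h2
      exact h2.trans h1)
    (fun k => (hcY (h.proj_left k).1 (h.proj_right k)).trans
      (mul_le_mul_of_nonneg_left (hdX (h.proj_left k)) hρ0))
  have hla : Filter.Tendsto l Filter.atTop (nhds (b - v)) := by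
    rw [← Filter.tendsto_add_atTop_iff_nat 1, tendsto_iff_norm_sub_tendsto_zero]
    refine squeeze_zero (fun k => norm_nonneg _) (fun k => ?_)
      (tendsto_iff_norm_sub_tendsto_zero.1 hby)
    have h1 := hfejX (h.proj_left k) _ hb
    rwa [sub_add_cancel] at h1
  refine ⟨b - v, hb.1, b, by simpa using hb.2, hla, hby, fun x hx z hz => ?_, fun h0 => ?_, hrate⟩
  · have := hnorm (b - v)
    rw [sub_add_cancel] at this
    rw [this]
    exact hmin x hx z hz
  -- The hypothesis on `l 0` is what covers `k = 0`; `hcX` never needs `l 0 ∈ X`, only `y 0 ∈ Y`.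
  · have hpr : ∀ k, IsProj (Y : Set V) (l k) (y k) := fun k => by
      cases k with
      | zero => exact h0
      | succ k => exact h.proj_right k
    obtain ⟨a, -, hal, hratel⟩ := exists_tendsto_of_fejer hclS hneS hρ0 hρ1 (s := l)
      (fun e he k => (hfejX (h.proj_left k) e he).trans (hfejY (hpr k) e he))
      (fun k => (hcX (hpr k).1 (h.proj_left k)).trans
        (mul_le_mul_of_nonneg_left (hdY (hpr k)) hρ0))
    rw [tendsto_nhds_unique hla hal]
    exact hratel

end APM

/-! ### The agents' polytope, the aggregate space and the explicit rate. -/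

section Aggregation

theorem exists_minimal_pair {V : Type*} [NormedAddCommGroup V] [ProperSpace V] {X Y : Set V}
    (hX : IsCompact X) (hXne : X.Nonempty) (hY : IsClosed Y) (hYne : Y.Nonempty) :
    ∃ x₀ ∈ X, ∃ y₀ ∈ Y, ∀ x ∈ X, ∀ z ∈ Y, ‖x₀ - y₀‖ ≤ ‖x - z‖ := by
  obtain ⟨x₀, hx₀, hmin⟩ := hX.exists_isMinOn hXne (Metric.continuous_infDist_pt Y).continuousOn
  obtain ⟨y₀, hy₀, heq⟩ := hY.exists_infDist_eq_dist hYne x₀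
  refine ⟨x₀, hx₀, y₀, hy₀, fun x hx z hz => ?_⟩
  rw [← dist_eq_norm, ← dist_eq_norm, ← heq]
  exact (hmin hx).trans (Metric.infDist_le_dist_of_mem hz)

variable {N T : ℕ}

theorem isCompact_feasibleSet (E : Fin N → ℝ) (lb ub : Fin N → Fin T → ℝ) :
    IsCompact (feasibleSet E lb ub) := by
  have hbox : IsCompact (Set.pi Set.univ fun i : Fin N × Fin T =>
      Set.Icc (lb i.1 i.2) (ub i.1 i.2)) := isCompact_univ_pi fun i => isCompact_Icc
  have hpre := (EuclideanSpace.equiv (Fin N × Fin T) ℝ).toHomeomorph.isCompact_preimage.2 hbox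
  refine hpre.of_isClosed_subset ?_ fun x hx i _ => (hx i.1).2 i.2
  have : feasibleSet E lb ub = {x | ∀ n, ∑ t, x (n, t) = E n ∧
      ∀ t, lb n t ≤ x (n, t) ∧ x (n, t) ≤ ub n t} := rfl
  rw [this]
  simp only [Set.ofPred_forall, Set.ofPred_and]
  refine isClosed_iInter fun n => (isClosed_eq (by fun_prop) continuous_const).inter
    (isClosed_iInter fun t => ?_)
  exact (isClosed_le continuous_const (by fun_prop)).inter
    (isClosed_le (by fun_prop) continuous_const)

theorem convex_feasibleSet (E : Fin N → ℝ) (lb ub : Fin N → Fin T → ℝ) :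
    Convex ℝ (feasibleSet E lb ub) := by
  intro x hx y hy a b ha hb hab n
  refine ⟨?_, fun t => ?_⟩
  · simp only [PiLp.add_apply, PiLp.smul_apply, smul_eq_mul, Finset.sum_add_distrib,
      ← Finset.mul_sum]
    have h1 := (hx n).1
    have h2 := (hy n).1
    simp only at h1 h2
    rw [h1, h2, ← add_mul, hab, one_mul]
  · exact convex_Icc (lb n t) (ub n t) ((hx n).2 t) ((hy n).2 t) ha hb hab

/-- The set `aggregateSet p`, as an affine subspace. -/
def aggregateSubspace (N : ℕ) (p : Fin T → ℝ) : AffineSubspace ℝ (Profile N T) where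
  carrier := aggregateSet p
  smul_vsub_vadd_mem' c x y z hx hy hz t := by
    have h1 := hx t
    have h2 := hy t
    have h3 := hz t
    simp only [vsub_eq_sub, vadd_eq_add, PiLp.add_apply, PiLp.smul_apply, PiLp.sub_apply,
      smul_eq_mul, Finset.sum_add_distrib, ← Finset.mul_sum, Finset.sum_sub_distrib, h1, h2, h3]
    ring

theorem mem_aggregateSubspace {p : Fin T → ℝ} {y : Profile N T} :
    y ∈ aggregateSubspace N p ↔ ∀ t, ∑ n, y (n, t) = p t := Iff.rfl

theorem isClosed_aggregateSet (p : Fin T → ℝ) : IsClosed (aggregateSet p : Set (Profile N T)) := by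
  simp only [aggregateSet, Set.ofPred_forall]
  exact isClosed_iInter fun t => isClosed_eq (by fun_prop) continuous_const

theorem aggregateSet_nonempty (hN : 1 ≤ N) (p : Fin T → ℝ) :
    (aggregateSet p : Set (Profile N T)).Nonempty := by
  refine ⟨WithLp.toLp 2 fun i => p i.2 / N, fun t => ?_⟩
  have : (N : ℝ) ≠ 0 := by positivity
  simp [mul_div_cancel₀ _ this]

theorem profile_norm_sq (x : Profile N T) : ‖x‖ ^ 2 = ∑ n, ∑ t, x (n, t) ^ 2 := by
  simp [EuclideanSpace.norm_sq_eq, Fintype.sum_prod_type]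

/-- The displacement from a feasible profile to the nearest feasible profile with prescribed
aggregate is reduced. -/
theorem IsProj.isReducedTransfer {E : Fin N → ℝ} {lb ub : Fin N → Fin T → ℝ} {p : Fin T → ℝ}
    {v x e : Profile N T} (hx : x ∈ feasibleSet E lb ub)
    (he : IsProj {e | e ∈ feasibleSet E lb ub ∧ e + v ∈ aggregateSubspace N p} x e) :
    IsReducedTransfer fun n t => e (n, t) - x (n, t) := by
  intro d' hrow hcol hbd
  -- Each coordinate of `e'` lies between those of `x` and `e`, so the bounds persist, and equal row
  -- and column sums keep `e'` a competitor of `e`.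
  let e' : Profile N T := x + WithLp.toLp 2 fun i => d' i.1 i.2
  have happ : ∀ n t, e' (n, t) = x (n, t) + d' n t := fun n t => rfl
  have hmem : e' ∈ {e | e ∈ feasibleSet E lb ub ∧ e + v ∈ aggregateSubspace N p} := by
    refine ⟨fun n => ⟨?_, fun t => ?_⟩, mem_aggregateSubspace.2 fun t => ?_⟩
    · have h1 := (he.1.1 n).1
      have h2 := hrow n
      simp only [happ, Finset.sum_add_distrib, Finset.sum_sub_distrib] at h1 h2 ⊢
      linarith
    · have h1 := (he.1.1 n).2 t
      have h2 := (hx n).2 t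
      have h3 := hbd n t
      simp only [happ] at h1 h2 h3 ⊢
      constructor
      · have : lb n t - x (n, t) ≤ min 0 (e (n, t) - x (n, t)) := le_min (by linarith) (by linarith)
        linarith
      · have : max 0 (e (n, t) - x (n, t)) ≤ ub n t - x (n, t) := max_le (by linarith) (by linarith)
        linarith
    · have h1 := mem_aggregateSubspace.1 he.1.2 t
      have h2 := hcol t
      simp only [PiLp.add_apply, happ, Finset.sum_add_distrib, Finset.sum_sub_distrib] at h1 h2 ⊢
      linarith
  have hle := pow_le_pow_left₀ (norm_nonneg _) (he.2 e' hmem) 2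
  rw [norm_sub_rev x e, norm_sub_rev x e', profile_norm_sq, profile_norm_sq] at hle
  simpa [happ] using hle

/-- The rate dominates the cosine given by the regularity estimate. -/
theorem apmRate_bounds (hN : 1 ≤ N) (hT : 2 ≤ T) :
    0 ≤ apmRate N T ∧ apmRate N T < 1 ∧
      1 - apmRate N T ^ 2 ≤ 1 / ((N : ℝ) * ((T : ℝ) * (T - 1) / 2)) := by
  have hN' : (1 : ℝ) ≤ N := by exact_mod_cast hN
  have hT' : (2 : ℝ) ≤ T := by exact_mod_cast hT
  have hT1 : (0 : ℝ) < T - 1 := by linarith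
  have hD : (9 : ℝ) ≤ (N : ℝ) * ((T : ℝ) + 1) ^ 2 * ((T : ℝ) - 1) := by
    have h1 : (9 : ℝ) ≤ ((T : ℝ) + 1) ^ 2 := by nlinarith
    have h2 : (9 : ℝ) ≤ N * ((T : ℝ) + 1) ^ 2 := by nlinarith
    nlinarith
  have hpos : 0 < 4 / ((N : ℝ) * ((T : ℝ) + 1) ^ 2 * ((T : ℝ) - 1)) := by positivity
  have hle1 : 4 / ((N : ℝ) * ((T : ℝ) + 1) ^ 2 * ((T : ℝ) - 1)) ≤ 1 := by
    rw [div_le_one (by linarith)]; linarith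
  -- Since `1 - ρ² ≤ 2(1 - ρ)`, it suffices that `4T ≤ (T + 1)²`, that is, `(T - 1)² ≥ 0`.
  have hcmp : 2 * (4 / ((N : ℝ) * ((T : ℝ) + 1) ^ 2 * ((T : ℝ) - 1))) ≤
      1 / ((N : ℝ) * ((T : ℝ) * (T - 1) / 2)) := by
    rw [← mul_div_assoc, div_le_div_iff₀ (by linarith) (by positivity)]
    have h : 0 ≤ (N : ℝ) * (T - 1) * (T - 1) ^ 2 := by positivity
    nlinarith
  unfold apmRate
  refine ⟨by linarith, by linarith, ?_⟩
  nlinarith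

theorem norm_sub_le_apmRate_mul (hN : 1 ≤ N) (hT : 2 ≤ T) {E : Fin N → ℝ}
    {lb ub : Fin N → Fin T → ℝ} {p : Fin T → ℝ} {x₀ y₀ : Profile N T}
    (hy₀ : y₀ ∈ aggregateSubspace N p)
    (hx₀ : x₀ ∈ feasibleSet E lb ub)
    (hmin : ∀ x ∈ feasibleSet E lb ub, ∀ z ∈ aggregateSubspace N p, ‖x₀ - y₀‖ ≤ ‖x - z‖)
    {x e z : Profile N T} (hx : x ∈ feasibleSet E lb ub)
    (he : IsProj {e | e ∈ feasibleSet E lb ub ∧ e + (y₀ - x₀) ∈ aggregateSubspace N p} x e)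
    (hz : IsProj (aggregateSubspace N p : Set (Profile N T)) x z) :
    ‖z - (e + (y₀ - x₀))‖ ≤ apmRate N T * ‖x - e‖ := by
  obtain ⟨hρ0, -, hρ⟩ := apmRate_bounds hN hT
  set v := y₀ - x₀ with hv
  have hN' : (1 : ℝ) ≤ N := by exact_mod_cast hN
  have hT' : (2 : ℝ) ≤ T := by exact_mod_cast hT
  have hev := he.1.2
  have hprojx₀ : IsProj (aggregateSubspace N p : Set (Profile N T)) x₀ y₀ :=
    ⟨hy₀, fun w hw => hmin x₀ hx₀ w hw⟩
  -- `x - (z - v)` is the difference of `x - z` and `x₀ - y₀`, both normal to the aggregate space.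
  have horth : inner ℝ (x - (z - v)) (z - (e + v)) = 0 := by
    have h1 := hz.inner_eq_zero hz.1 hev
    have h2 := hprojx₀.inner_eq_zero hz.1 hev
    have : x - (z - v) = (x - z) - (x₀ - y₀) := by rw [hv]; abel
    rw [this, inner_sub_left, h1, h2, sub_zero]
  have hpyth : ‖x - e‖ ^ 2 = ‖x - (z - v)‖ ^ 2 + ‖z - (e + v)‖ ^ 2 := by
    have h1 := norm_add_sq_real (x - (z - v)) (z - (e + v))
    rw [horth] at h1
    have : x - (z - v) + (z - (e + v)) = x - e := by abel
    rw [this] at h1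
    linarith
  have hred := he.isReducedTransfer hx
  have hreg := hred.sum_sq_le (fun n => by
    have h1 := (he.1.1 n).1
    have h2 := (hx n).1
    simp only at h1 h2
    rw [Finset.sum_sub_distrib, h1, h2, sub_self]) (by simpa using hT)
  have hnorm : ‖x - e‖ ^ 2 = ∑ n, ∑ t, (e (n, t) - x (n, t)) ^ 2 := by
    rw [norm_sub_rev, profile_norm_sq]; rfl
  -- `z` and `e + v` have the same column sums, so those of `e - x` and `x - (z - v)` are opposite;
  -- Cauchy–Schwarz over the agents gives the factor `N`.
  have hcol : ∑ t, (∑ n, (e (n, t) - x (n, t))) ^ 2 ≤ N * ‖x - (z - v)‖ ^ 2 := by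
    rw [profile_norm_sq, Finset.sum_comm, Finset.mul_sum]
    refine Finset.sum_le_sum fun t _ => ?_
    have h1 := mem_aggregateSubspace.1 hz.1 t
    have h2 := mem_aggregateSubspace.1 hev t
    have h3 : ∑ n, (e (n, t) - x (n, t)) = - ∑ n, (x - (z - v)) (n, t) := by
      simp only [PiLp.sub_apply, PiLp.add_apply, Finset.sum_add_distrib,
        Finset.sum_sub_distrib] at h1 h2 ⊢
      linarith
    rw [h3, neg_sq]
    simpa using sq_sum_le_card_mul_sum_sq (s := Finset.univ)
      (f := fun n => (x - (z - v)) (n, t))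
  rw [← hnorm, Fintype.card_fin] at hreg
  have hK : 0 < (T : ℝ) * (T - 1) / 2 := by
    have : (0 : ℝ) < T - 1 := by linarith
    positivity
  have hlow : 1 / ((N : ℝ) * ((T : ℝ) * (T - 1) / 2)) * ‖x - e‖ ^ 2 ≤ ‖x - (z - v)‖ ^ 2 := by
    rw [one_div_mul_eq_div, div_le_iff₀ (by positivity)]
    have := mul_le_mul_of_nonneg_left hcol hK.le
    linarith
  have h5 := mul_le_mul_of_nonneg_right hρ (sq_nonneg ‖x - e‖)
  refine (pow_le_pow_iff_left₀ (norm_nonneg _) (mul_nonneg hρ0 (norm_nonneg _)) two_ne_zero).1 ?_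
  rw [mul_pow]
  linarith

end Aggregation

theorem mainTheorem2 (N T : ℕ) (hN : 1 ≤ N) (hT : 2 ≤ T)
    (E : Fin N → ℝ) (lb ub : Fin N → Fin T → ℝ) (p : Fin T → ℝ)
    (hX : (feasibleSet E lb ub).Nonempty)
    (l y : ℕ → Profile N T)
    (hAPM : IsAPM (feasibleSet E lb ub) (aggregateSet p) l y) :
    apmRate N T < 1 ∧
    ∃ lInf ∈ feasibleSet E lb ub, ∃ yInf ∈ (aggregateSet p : Set (Profile N T)),
      Filter.Tendsto l Filter.atTop (nhds lInf) ∧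
      Filter.Tendsto y Filter.atTop (nhds yInf) ∧
      (∀ x ∈ feasibleSet E lb ub, ∀ z ∈ (aggregateSet p : Set (Profile N T)),
        ‖lInf - yInf‖ ≤ ‖x - z‖) ∧
      (IsProj (aggregateSet p) (l 0) (y 0) →
        ∀ k : ℕ, ‖l k - lInf‖ ≤ 2 * ‖l 0 - lInf‖ * apmRate N T ^ k) ∧
      (∀ k : ℕ, ‖y k - yInf‖ ≤ 2 * ‖y 0 - yInf‖ * apmRate N T ^ k) := by
  obtain ⟨hρ0, hρ1, -⟩ := apmRate_bounds hN hT
  obtain ⟨x₀, hx₀, y₀, hy₀, hmin⟩ := exists_minimal_pair (isCompact_feasibleSet E lb ub) hX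
    (isClosed_aggregateSet p) (aggregateSet_nonempty hN p)
  exact ⟨hρ1, IsAPM.exists_limits (Y := aggregateSubspace N p) (isCompact_feasibleSet E lb ub)
    (convex_feasibleSet E lb ub) (isClosed_aggregateSet p) hx₀ hy₀ hmin hρ0 hρ1
    (fun x hx e he z hz => norm_sub_le_apmRate_mul hN hT hy₀ hx₀ hmin hx he hz) hAPM⟩
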